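/- Let $\mathcal P$ be a commutative ring with identity $1\neq 0$ (for instance a principal ideal domain). Let $G$ be a finite loopless signed multidigraph, with $m_{uw}$ arcs from $u$ to $w$, all of the same sign $\sigma(uw)\in\{1,-1\}$. Its generalized Laplacian $L(G,X)$ is the matrix over $\mathcal P[x_u : u\in V(G)]$ with diagonal entries $x_u$ and entries $-\sigma(uw)m_{uw}$ for $u\neq w$. Its $i$-th critical ideal $I_i(G,X)$ is the ideal generated by the $i\times i$ minors of $L(G,X)$ (so $I_0=\langle 1\rangle$, and $I_i=\langle 0\rangle$ for $i>|V(G)|$), and its algebraic co-rank $\gamma(G)$ is the largest $i$ with $I_i(G,X)=\langle 1\rangle$. For a vertex $v$ of $G$ and $K\ge 0$ let $d^K(G,v)$ be obtained from $G$ by duplicating $v$ a total of $K$ times, that is, by adding new vertices $v^1,\dots,v^K$ such that for each vertex $u\neq v$ of $G$ the arcs between $v^t$ and $u$, in both directions, agree in number and sign with those between $v$ and $u$, and such that there are no arcs among $v^0=v,v^1,\dots,v^K$; put $d(G,v)=d^1(G,v)$. Let $$P_l^K(v)=\Bigl\{\prod_{c\in C}x_{v^c} : C\subseteq\{0,\dots,K\},\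 |C|=l\Bigr\}.$$ Put $\gamma_d=\gamma(d(G,v))$, $\gamma_v=\gamma(G-v)$, and $\lambda=0$ if $\gamma_v=\gamma_d$, $\lambda=1$ otherwise. If $\gamma(G)\ge 2$, then $0\le\gamma_d-\gamma_v\le 2$, and for all integers $k\ge 1$ and $i\ge 0$ we have in the polynomial ring over $\mathcal P$ in the variables of $d^{k+\lambda+i}(G,v)$ $$I_{\gamma_d+k}\bigl(d^{k+\lambda+i}(G,v),X\bigr)=\Bigl\langle\, p\cdot f|_{x_v=0} \;:\; 0\le l\le k,\ p\in P_l^{k+\lambda+i}(v),\ f\in I_{\gamma_d+k-l}(G,X)\Bigr\rangle .$$ -/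

import Mathlib

open MvPolynomial

noncomputable section

/-- A loopless signed multidigraph on the vertex set `V`: `mult u w` is the number of arcs
from `u` to `w`, and `sign u w` is the common sign `1` or `-1` of these arcs (irrelevant when
`mult u w = 0`). -/
structure SignedMultidigraph (V : Type*) where
  mult : V → V → ℕ
  sign : V → V → ℤˣ
  loopless : ∀ u, mult u u = 0

namespace SignedMultidigraph

/-- The pull-back of a signed multidigraph along a map of vertex sets: the arcs from `p` to `q`
are copies of the arcs from `f p` to `f q`. -/
def comap {V W : Type*} (f : W → V) (G : SignedMultidigraph V) : SignedMultidigraph W where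
  mult p q := G.mult (f p) (f q)
  sign p q := G.sign (f p) (f q)
  loopless p := G.loopless (f p)

/-- The induced subgraph `G - v`. -/
def deleteVertex {V : Type*} (G : SignedMultidigraph V) (v : V) :
    SignedMultidigraph {u : V // u ≠ v} :=
  G.comap Subtype.val

/-- `d^k(G, v)`: the vertex `v` is duplicated `k` times. The vertices of `G` are `Sum.inl u`, and
the `k` new vertices `Sum.inr s` have exactly the arcs of `v`, with multiplicities and signs; as
`G` is loopless, there are no arcs among the copies of `v`. -/
def duplicate {V : Type*} (G : SignedMultidigraph V) (v : V) (k : ℕ) :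
    SignedMultidigraph (V ⊕ Fin k) :=
  G.comap (Sum.elim id (fun _ => v))

/-- The generalized Laplacian matrix `L(G, X)` over the polynomial ring `R[x_u : u ∈ V]`. -/
def laplacian {V : Type*} [DecidableEq V] (R : Type*) [CommRing R] (G : SignedMultidigraph V) :
    Matrix V V (MvPolynomial V R) :=
  Matrix.of fun u w =>
    if u = w then X u else -C (((G.sign u w : ℤ) : R) * ((G.mult u w : ℕ) : R))

/-- The `i`-th critical ideal `I_i(G, X)`, generated by the `i × i` minors of `L(G, X)`.
A submatrix is given by an enumeration of its `i` rows and of its `i` columns; the choice of the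
enumeration changes the minor only by a sign. So the ideal is `⊤` for `i = 0` and `⊥` for
`i > |V|`. -/
def criticalIdeal {V : Type*} [DecidableEq V] (R : Type*) [CommRing R] (G : SignedMultidigraph V)
    (i : ℕ) : Ideal (MvPolynomial V R) :=
  Ideal.span {p | ∃ r c : Fin i ↪ V, p = ((G.laplacian R).submatrix r c).det}

open Classical in
/-- The algebraic co-rank: the largest `i ≤ |V|` such that `I_i(G, X)` is trivial, i.e. equal to
the whole polynomial ring. -/
def corank {V : Type*} [Fintype V] [DecidableEq V] (R : Type*) [CommRing R]
    (G : SignedMultidigraph V) : ℕ :=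
  Nat.findGreatest (fun i => G.criticalIdeal R i = ⊤) (Fintype.card V)

end SignedMultidigraph

/-- The vertex `v^t` of `d^k(G, v)` for `t = 0, …, k`, with `v^0 = v`. -/
def twin {V : Type*} (v : V) (k : ℕ) : Fin (k + 1) → V ⊕ Fin k :=
  Fin.cases (Sum.inl v) Sum.inr

/-- `P_l^k(v)`: the products of `l` distinct variables among `x_{v^0}, …, x_{v^k}`. -/
def twinProducts {V : Type*} (R : Type*) [CommRing R] (v : V) (k l : ℕ) :
    Set (MvPolynomial (V ⊕ Fin k) R) :=
  {p | ∃ S : Finset (Fin (k + 1)), S.card = l ∧ p = ∏ t ∈ S, X (twin v k t)}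

/-- The evaluation `f ↦ f|_{x_v = 0}`. -/
def evalZero {V : Type*} [DecidableEq V] (R : Type*) [CommRing R] (v : V) :
    MvPolynomial V R →ₐ[R] MvPolynomial V R :=
  aeval fun u => if u = v then 0 else X u

/-- The constant `λ(r, s)`. -/
def regularityConst (r s : ℕ) : ℕ := if r = s then 0 else 1

end

/-! Let `N` be `L(G)` at `x_v = 0`. Collapsing all copies of `v` to `v`, the Laplacian of `d^K(G,
v)` is a pulled-back copy of `N` plus a diagonal matrix carrying the variables of the copies
(`laplacian_duplicate`). Expanding a minor by rows gives sums of products of copy variables times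
smaller minors of `N`. Products of more than `k` variables are absorbed, since the minors of `N` of
size `γ_d` generate the unit ideal. Conversely, a product over a set `C` of copies times a minor of
`N` is the leading term of a minor of `d^K(G, v)`: add the copies in `C` to rows and columns, and
lift the remaining rows and columns to two distinct copies outside `C`. The other terms have fewer
variables, so induction on `|C|` applies (`twin_prod_mul_mem_criticalIdeal`). Two spare copies can
be missing only if `K = k = |C|`; then `γ_v = γ_d`, and minors of `N` avoiding `v` already generate
everything. -/

/-! ### Determinantal ideals. -/

section Minors

variable {m n S : Type*} [CommRing S]

/-- The determinantal ideal of a matrix, generated by its `i × i` minors. -/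
def minorIdeal (A : Matrix m n S) (i : ℕ) : Ideal S :=
  Ideal.span {p | ∃ (r : Fin i ↪ m) (c : Fin i ↪ n), p = (A.submatrix r c).det}

/-- A repeated row or column makes the determinant zero, so injectivity is not needed. This lets
minors be pulled back along the non-injective `collapse`. -/
theorem det_submatrix_mem_minorIdeal {ι : Type*} [Fintype ι] [DecidableEq ι] (A : Matrix m n S)
    (r : ι → m) (c : ι → n) : (A.submatrix r c).det ∈ minorIdeal A (Fintype.card ι) := by
  by_cases hr : Function.Injective r
  · by_cases hc : Function.Injective c
    · let e := (Fintype.equivFin ι).symm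
      rw [← Matrix.det_submatrix_equiv_self e]
      exact Ideal.subset_span ⟨⟨r ∘ e, hr.comp e.injective⟩, ⟨c ∘ e, hc.comp e.injective⟩, rfl⟩
    · obtain ⟨a, b, hab, hne⟩ := Function.not_injective_iff.mp hc
      rw [Matrix.det_zero_of_column_eq hne fun k => by simp [hab]]
      exact zero_mem _
  · obtain ⟨a, b, hab, hne⟩ := Function.not_injective_iff.mp hr
    rw [Matrix.det_zero_of_row_eq hne (by ext k; simp [hab])]
    exact zero_mem _

theorem mul_mem_of_mem_minorIdeal {A : Matrix m n S} {i : ℕ}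
    {J : Ideal S} {p g : S}
    (h : ∀ (r : Fin i ↪ m) (c : Fin i ↪ n), p * (A.submatrix r c).det ∈ J)
    (hg : g ∈ minorIdeal A i) : p * g ∈ J := by
  have : minorIdeal A i ≤ Submodule.comap (LinearMap.mulLeft S p) J := by
    refine Ideal.span_le.mpr ?_
    rintro _ ⟨r, c, rfl⟩
    exact h r c
  exact this hg

theorem minorIdeal_submatrix_le {m' n' : Type*} (A : Matrix m n S) (f : m' → m) (g : n' → n)
    (i : ℕ) : minorIdeal (A.submatrix f g) i ≤ minorIdeal A i := by
  refine Ideal.span_le.mpr ?_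
  rintro _ ⟨r, c, rfl⟩
  simpa using det_submatrix_mem_minorIdeal A (f ∘ r) (g ∘ c)

theorem minorIdeal_transpose_le (A : Matrix m n S) (i : ℕ) :
    minorIdeal A.transpose i ≤ minorIdeal A i := by
  refine Ideal.span_le.mpr ?_
  rintro _ ⟨r, c, rfl⟩
  rw [← Matrix.det_transpose]
  exact Ideal.subset_span ⟨c, r, rfl⟩

theorem map_minorIdeal {S' : Type*} [CommRing S'] (φ : S →+* S') (A : Matrix m n S) (i : ℕ) :
    (minorIdeal A i).map φ = minorIdeal (A.map φ) i := by
  rw [minorIdeal, Ideal.map_span, minorIdeal]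
  congr 1
  ext p
  constructor
  · rintro ⟨_, ⟨r, c, rfl⟩, rfl⟩
    exact ⟨r, c, by rw [RingHom.map_det]; rfl⟩
  · rintro ⟨r, c, rfl⟩
    exact ⟨_, ⟨r, c, rfl⟩, by rw [RingHom.map_det]; rfl⟩

theorem minorIdeal_zero (A : Matrix m n S) : minorIdeal A 0 = ⊤ := by
  rw [Ideal.eq_top_iff_one]
  exact Ideal.subset_span ⟨⟨Fin.elim0, fun a => a.elim0⟩, ⟨Fin.elim0, fun a => a.elim0⟩, by simp⟩

/-- Laplace expansion along the rows in `T`. -/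
theorem det_fin_mem_minorIdeal (A : Matrix m n S) (l : ℕ) :
    ∀ (k : ℕ) (T : Finset (Fin k)) (_ : T.card = l) (M : Matrix (Fin k) (Fin k) S)
      (r : Fin k → m) (c : Fin k → n) (_ : ∀ i ∉ T, ∀ j, M i j = A (r i) (c j)),
      M.det ∈ minorIdeal A (k - l) := by
  induction l with
  | zero =>
    intro k T hT M r c h
    rw [Finset.card_eq_zero] at hT
    subst hT
    have : M = A.submatrix r c := by ext i j; exact h i (by simp) j
    rw [this]
    simpa using det_submatrix_mem_minorIdeal A r c
  | succ l ih =>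
    intro k T hT M r c h
    obtain ⟨s, hs⟩ : T.Nonempty := Finset.card_pos.mp (by omega)
    cases k with
    | zero => exact s.elim0
    | succ k =>
      rw [Matrix.det_succ_row M s, Nat.add_sub_add_right]
      refine sum_mem fun j _ => Ideal.mul_mem_left _ _ ?_
      refine ih k (Finset.univ.filter fun i => s.succAbove i ∈ T) ?_ _ (r ∘ s.succAbove)
        (c ∘ j.succAbove) ?_
      · have : (Finset.univ.filter fun i => s.succAbove i ∈ T).map s.succAboveEmb = T.erase s := by
          ext a
          simp only [Finset.mem_map, Finset.mem_filter, Finset.mem_univ, true_and,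
            Finset.mem_erase, Fin.coe_succAboveEmb]
          constructor
          · rintro ⟨b, hb, rfl⟩
            exact ⟨Fin.succAbove_ne s b, hb⟩
          · rintro ⟨hne, ha⟩
            obtain ⟨b, rfl⟩ := Fin.exists_succAbove_eq hne
            exact ⟨b, ha, rfl⟩
        rw [← Finset.card_map, this, Finset.card_erase_of_mem hs, hT, Nat.add_sub_cancel]
      · intro i hi j'
        exact h _ (by simpa using hi) _

theorem det_mem_minorIdeal_of_rows {ι : Type*} [Fintype ι] [DecidableEq ι] (A : Matrix m n S)
    (T : Finset ι) (M : Matrix ι ι S) (r : ι → m) (c : ι → n)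
    (h : ∀ i ∉ T, ∀ j, M i j = A (r i) (c j)) :
    M.det ∈ minorIdeal A (Fintype.card ι - T.card) := by
  let e := Fintype.equivFin ι
  rw [← Matrix.det_submatrix_equiv_self e.symm]
  refine det_fin_mem_minorIdeal A _ _ (T.map e.toEmbedding) (by simp) _ (r ∘ e.symm)
    (c ∘ e.symm) ?_
  intro i hi j
  refine h _ (fun hT => hi ?_) _
  exact Finset.mem_map.mpr ⟨_, hT, by simp⟩

/-- Deleting one row lowers the size of the minors by at most one. -/
theorem minorIdeal_succ_le_deleteRow (A : Matrix m n S) (v : m) (i : ℕ) :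
    minorIdeal A (i + 1) ≤ minorIdeal (A.submatrix (Subtype.val : {u // u ≠ v} → m) id) i := by
  refine Ideal.span_le.mpr ?_
  rintro _ ⟨r, c, rfl⟩
  -- `s` is the position of row `v`, or arbitrary if the minor does not use that row.
  obtain ⟨s, hs⟩ : ∃ s, ∀ a, a ≠ s → r a ≠ v := by
    by_cases h : ∃ s, r s = v
    · obtain ⟨s, hs⟩ := h
      exact ⟨s, fun a ha hav => ha (r.injective (hav.trans hs.symm))⟩
    · exact ⟨0, fun a _ hav => h ⟨a, hav⟩⟩
  rw [Matrix.det_succ_row _ s]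
  refine sum_mem fun j _ => Ideal.mul_mem_left _ _ ?_
  have := det_submatrix_mem_minorIdeal (A.submatrix (Subtype.val : {u // u ≠ v} → m) id)
    (fun a : Fin i => ⟨r (s.succAbove a), hs _ (Fin.succAbove_ne s a)⟩) (c ∘ j.succAbove)
  simpa [Function.comp_def] using this

theorem minorIdeal_add_two_le (A : Matrix m m S) (v : m) (i : ℕ) :
    minorIdeal A (i + 2) ≤
      minorIdeal (A.submatrix (Subtype.val : {u // u ≠ v} → m)
        (Subtype.val : {u // u ≠ v} → m)) i := by
  refine (minorIdeal_succ_le_deleteRow A v (i + 1)).trans ?_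
  refine (minorIdeal_transpose_le
    (A.submatrix (Subtype.val : {u // u ≠ v} → m) id).transpose (i + 1)).trans ?_
  refine (minorIdeal_succ_le_deleteRow _ v i).trans ?_
  exact minorIdeal_transpose_le
    (A.submatrix (Subtype.val : {u // u ≠ v} → m) (Subtype.val : {u // u ≠ v} → m)) i

end Minors

/-! ### Minors of a diagonal matrix plus a pulled-back matrix. -/

section DiagonalPerturbation

variable {V W S : Type*} [DecidableEq W] [CommRing S]

/-- The expansion of a minor of `diagonal y + B` over the sets of rows taken from the diagonal
part. -/
theorem det_submatrix_diagonal_add {ι : Type*} [Fintype ι] [DecidableEq ι] (y : W → S)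
    (B : Matrix W W S) (r c : ι → W) :
    ((Matrix.diagonal y + B).submatrix r c).det =
      ∑ T : Finset ι, (∏ i ∈ T, y (r i)) *
        (Matrix.of fun i j => if i ∈ T then (if r i = c j then 1 else 0) else B (r i) (c j)).det := by
  have h := (Matrix.detRowAlternating (R := S) (n := ι)).toMultilinearMap.map_add_univ
    (fun i j => Matrix.diagonal y (r i) (c j)) (fun i j => B (r i) (c j))
  refine Eq.trans ?_ (h.trans ?_)
  · rfl
  · refine Finset.sum_congr rfl fun T _ => ?_
    have hp : ∏ i ∈ T, y (r i) = ∏ i, if i ∈ T then y (r i) else 1 := by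
      rw [Finset.prod_ite_mem, Finset.univ_inter]
    rw [hp, ← Matrix.det_mul_column]
    refine congrArg Matrix.det ?_
    ext i j
    by_cases hi : i ∈ T <;> by_cases hij : r i = c j <;>
      simp [Finset.piecewise, hi, hij]

/-- If the minor of `diagonal y + N.submatrix f f` on the rows `w, r` and the columns `w, c` is in
`J`, and `J` contains the lower terms of its expansion, then `J` contains the leading term. -/
theorem leading_term_mem {κ ι : Type*} [Fintype κ] [DecidableEq κ] [Fintype ι] [DecidableEq ι]
    (y : W → S) (N : Matrix V V S) (f : W → V) (w : κ → W) (hw : Function.Injective w)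
    (r c : ι → W) (hc : ∀ t a, w t ≠ c a)
    (hr : ∀ a, y (r a) = 0 ∨ ((∀ t, r a ≠ w t) ∧ ∀ b, r a ≠ c b)) (J : Ideal S)
    (hdet : ((Matrix.diagonal y + N.submatrix f f).submatrix
      (Sum.elim w r) (Sum.elim w c)).det ∈ J)
    (hJ : ∀ T : Finset κ, T ≠ Finset.univ →
      ∀ g ∈ minorIdeal N (Fintype.card κ + Fintype.card ι - T.card),
        (∏ t ∈ T, y (w t)) * g ∈ J) :
    (∏ t, y (w t)) * (N.submatrix (f ∘ r) (f ∘ c)).det ∈ J := by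
  -- The leading term takes the diagonal part in all rows `w` and in no row `r`.
  rw [det_submatrix_diagonal_add, Fintype.sum_eq_add_sum_compl
    ((Finset.univ : Finset κ).disjSum (∅ : Finset ι))] at hdet
  have hrest := (Submodule.add_mem_iff_left J (sum_mem fun T hT => ?_)).mp hdet
  · refine cast (congrArg (· ∈ J) ?_) hrest
    congr 1
    · simp
    · have : (Matrix.of fun i j : κ ⊕ ι =>
          if i ∈ (Finset.univ : Finset κ).disjSum (∅ : Finset ι) then
            (if Sum.elim w r i = Sum.elim w c j then (1 : S) else 0)
          else N.submatrix f f (Sum.elim w r i) (Sum.elim w c j)) =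
          Matrix.fromBlocks 1 0 (N.submatrix (f ∘ r) (f ∘ w)) (N.submatrix (f ∘ r) (f ∘ c)) := by
        ext (i | i) (j | j)
        · simp [Matrix.one_apply, hw.eq_iff]
        · simp [hc]
        · simp
        · simp
      rw [this, Matrix.det_fromBlocks_zero₁₂, Matrix.det_one, one_mul]
  · rw [Finset.mem_compl, Finset.mem_singleton] at hT
    -- A diagonal row from `r` kills the term: its weight is zero, or its only nonzero entry lies
    -- outside the chosen columns.
    by_cases h : ∃ a, Sum.inr a ∈ T
    · obtain ⟨a, ha⟩ := h
      rcases hr a with h0 | ⟨h1, h2⟩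
      · rw [Finset.prod_eq_zero ha (by simpa using h0), zero_mul]
        exact zero_mem _
      · rw [Matrix.det_eq_zero_of_row_eq_zero (Sum.inr a), mul_zero]
        · exact zero_mem _
        · rintro (t | b)
          · simp [ha, h1]
          · simp [ha, h2]
    · have hR : T.toRight = ∅ := by
        ext a
        simpa using fun ha => h ⟨a, ha⟩
      have hT' : T = T.toLeft.disjSum ∅ := by
        rw [← hR, Finset.toLeft_disjSum_toRight]
      have hcard : T.card = T.toLeft.card := by
        conv_lhs => rw [hT', Finset.card_disjSum]
        simp
      have hprod : ∏ i ∈ T, y (Sum.elim w r i) = ∏ t ∈ T.toLeft, y (w t) := by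
        conv_lhs => rw [hT', Finset.prod_disjSum]
        simp
      rw [hprod]
      refine hJ _ (fun hu => hT (by rw [hT', hu])) _ ?_
      rw [← hcard, ← Fintype.card_sum]
      refine det_mem_minorIdeal_of_rows N T _ (f ∘ Sum.elim w r) (f ∘ Sum.elim w c) ?_
      intro i hi j
      simp [hi]

end DiagonalPerturbation

/-! ### Copies of `v`. -/

section Twins

variable {V : Type*} (v : V) (K : ℕ)

/-- The map sending every copy of `v` to `v`. -/
def collapse : V ⊕ Fin K → V := Sum.elim id fun _ => v

theorem collapse_twin (t : Fin (K + 1)) : collapse v K (twin v K t) = v := by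
  cases t using Fin.cases <;> rfl

theorem twin_injective : Function.Injective (twin v K) := by
  intro s t
  cases s using Fin.cases <;> cases t using Fin.cases <;> simp [twin]

theorem exists_twin_eq {w : V ⊕ Fin K} (hw : collapse v K w = v) : ∃ t, twin v K t = w := by
  rcases w with u | s
  · exact ⟨0, congrArg Sum.inl (Eq.symm hw)⟩
  · exact ⟨s.succ, rfl⟩

theorem prod_mem_twinProducts (R : Type*) [CommRing R] {ι : Type*} (T : Finset ι)
    (r : ι → V ⊕ Fin K) (hr : Set.InjOn r T) (h : ∀ i ∈ T, collapse v K (r i) = v) :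
    ∏ i ∈ T, X (r i) ∈ twinProducts R v K T.card := by
  classical
  let τ : V ⊕ Fin K → Fin (K + 1) := Sum.elim (fun _ => 0) Fin.succ
  have hτ : ∀ i ∈ T, twin v K (τ (r i)) = r i := by
    intro i hi
    obtain ⟨t, ht⟩ := exists_twin_eq v K (h i hi)
    rw [← ht]
    congr 1
    cases t using Fin.cases <;> rfl
  have hinj : Set.InjOn (fun i => τ (r i)) T := by
    intro a ha b hb hab
    refine hr ha hb ?_
    rw [← hτ a ha, ← hτ b hb]
    exact congrArg _ hab
  refine ⟨T.image fun i => τ (r i), Finset.card_image_of_injOn hinj, ?_⟩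
  rw [Finset.prod_image hinj]
  exact Finset.prod_congr rfl fun i hi => by rw [hτ i hi]

variable [DecidableEq V]

/-- The section of `collapse` that sends `v` to its copy with index `t`. -/
def liftTwin (t : Fin (K + 1)) (u : V) : V ⊕ Fin K := if u = v then twin v K t else Sum.inl u

theorem collapse_liftTwin (t : Fin (K + 1)) (u : V) : collapse v K (liftTwin v K t u) = u := by
  unfold liftTwin
  split_ifs with h
  · rw [collapse_twin, h]
  · rfl

theorem liftTwin_eq_twin {t s : Fin (K + 1)} {u : V} (h : liftTwin v K t u = twin v K s) :
    t = s := by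
  have hu : u = v := by rw [← collapse_liftTwin v K t u, h, collapse_twin]
  rw [liftTwin, if_pos hu] at h
  exact twin_injective v K h

end Twins

/-! ### Critical ideals of `d^K(G, v)`. -/

namespace SignedMultidigraph

variable {V : Type*} [DecidableEq V] (R : Type*) [CommRing R] (G : SignedMultidigraph V) (v : V)

theorem criticalIdeal_eq_minorIdeal (i : ℕ) :
    G.criticalIdeal R i = minorIdeal (G.laplacian R) i := rfl

theorem criticalIdeal_corank [Fintype V] : G.criticalIdeal R (G.corank R) = ⊤ := by
  classical
  unfold corank
  exact Nat.findGreatest_spec (P := fun i => G.criticalIdeal R i = ⊤) (Nat.zero_le _)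
    (minorIdeal_zero _)

theorem le_corank [Fintype V] {i : ℕ} (hi : i ≤ Fintype.card V) (h : G.criticalIdeal R i = ⊤) :
    i ≤ G.corank R := by
  classical
  exact Nat.le_findGreatest hi h

theorem corank_le_card [Fintype V] : G.corank R ≤ Fintype.card V :=
  Nat.findGreatest_le _

theorem laplacian_comap_map_rename {W : Type*} [DecidableEq W] (h : W → V)
    (hh : Function.Injective h) :
    ((G.comap h).laplacian R).map (rename h : MvPolynomial W R →ₐ[R] MvPolynomial V R).toRingHom =
      (G.laplacian R).submatrix h h := by
  ext1 p q
  by_cases hpq : p = q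
  · subst hpq
    simp [laplacian]
  · simp [laplacian, comap, hpq, hh.eq_iff]

theorem minorIdeal_laplacian_comap_eq_top {W : Type*} [DecidableEq W] (h : W → V)
    (hh : Function.Injective h) {i : ℕ} (ht : (G.comap h).criticalIdeal R i = ⊤) :
    minorIdeal ((G.laplacian R).submatrix h h) i = ⊤ := by
  rw [← laplacian_comap_map_rename R G h hh, ← map_minorIdeal, ← criticalIdeal_eq_minorIdeal, ht,
    Ideal.map_top]

/-- The weight of the diagonal part of the Laplacian of `d^K(G, v)`: the variables of the copies
of `v`. -/
noncomputable def twinWeight (K : ℕ) (w : V ⊕ Fin K) : MvPolynomial (V ⊕ Fin K) R :=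
  if collapse v K w = v then X w else 0

/-- The evaluation `f ↦ f|_{x_v = 0}` with values in the polynomial ring of `d^K(G, v)`. -/
noncomputable def evalZeroRename (K : ℕ) : MvPolynomial V R →+* MvPolynomial (V ⊕ Fin K) R :=
  ((rename Sum.inl).comp (evalZero R v)).toRingHom

/-- Two distinct copies of `v` are not adjacent, which matches the `(v, v)` entry `x_v` becoming
zero. -/
theorem laplacian_duplicate (K : ℕ) :
    (G.duplicate v K).laplacian R = Matrix.diagonal (twinWeight R v K) +
      ((G.laplacian R).map (evalZeroRename R v K)).submatrix (collapse v K) (collapse v K) := by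
  ext1 p q
  by_cases hpq : p = q
  · subst hpq
    by_cases hp : collapse v K p = v
    · simp [laplacian, twinWeight, evalZeroRename, evalZero, hp]
    · rcases p with u | s
      · have hu : u ≠ v := hp
        simp [laplacian, twinWeight, evalZeroRename, evalZero, collapse, hu]
      · exact absurd rfl hp
  · by_cases hc : collapse v K p = collapse v K q
    · have hv : collapse v K q = v := by
        rcases p with u | s
        · rcases q with u' | s'
          · exact absurd (congrArg Sum.inl hc) hpq
          · rfl
        · exact hc.symm
      have h0 : (G.duplicate v K).mult p q = 0 := by
        change G.mult (collapse v K p) (collapse v K q) = 0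
        rw [hc, G.loopless]
      simp [laplacian, hpq, hc, hv, h0, evalZeroRename, evalZero]
    · have h1 : (G.duplicate v K).mult p q = G.mult (collapse v K p) (collapse v K q) := rfl
      have h2 : (G.duplicate v K).sign p q = G.sign (collapse v K p) (collapse v K q) := rfl
      simp [laplacian, hpq, hc, h1, h2, evalZeroRename, evalZero]

/-- Setting the variables of all copies of `v` to zero turns the minors of `d^K(G, v)` into minors
of `G` at `x_v = 0`, or zero. -/
theorem map_evalZero_criticalIdeal_eq_top {K i : ℕ}
    (h : (G.duplicate v K).criticalIdeal R i = ⊤) :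
    (G.criticalIdeal R i).map (evalZero R v).toRingHom = ⊤ := by
  let ψ : MvPolynomial (V ⊕ Fin K) R →ₐ[R] MvPolynomial V R :=
    aeval (Sum.elim (fun u => if u = v then 0 else X u) fun _ => 0)
  have hψ : ((G.duplicate v K).laplacian R).map ψ.toRingHom =
      ((G.laplacian R).map (evalZero R v).toRingHom).submatrix (collapse v K) (collapse v K) := by
    have hcomp : ∀ p, ψ (evalZeroRename R v K p) = evalZero R v p := by
      intro p
      have : (ψ.comp (rename Sum.inl)).comp (evalZero R v) = evalZero R v := by
        ext u
        by_cases hu : u = v <;> simp [ψ, evalZero, hu]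
      exact DFunLike.congr_fun this p
    rw [laplacian_duplicate]
    ext1 p q
    have hd : ψ (Matrix.diagonal (twinWeight R v K) p q) = 0 := by
      by_cases hpq : p = q
      · subst hpq
        rw [Matrix.diagonal_apply_eq, twinWeight]
        split_ifs with hp
        · rcases p with u | s
          · have hu : u = v := hp
            simp [ψ, hu]
          · simp [ψ]
        · exact map_zero _
      · rw [Matrix.diagonal_apply_ne _ hpq, map_zero]
    change ψ (Matrix.diagonal (twinWeight R v K) p q +
      evalZeroRename R v K (G.laplacian R (collapse v K p) (collapse v K q))) = _
    rw [map_add, hd, zero_add, hcomp]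
    rfl
  rw [criticalIdeal_eq_minorIdeal, map_minorIdeal, eq_top_iff]
  refine le_trans ?_ (minorIdeal_submatrix_le _ (collapse v K) (collapse v K) i)
  rw [← hψ, ← map_minorIdeal, ← criticalIdeal_eq_minorIdeal, h, Ideal.map_top]

/-- The conclusion concerns only `G` at `x_v = 0`, so `K'` is free: triviality for one duplication
serves every number of copies. -/
theorem map_evalZeroRename_eq_top {K i : ℕ} (K' : ℕ)
    (h : (G.duplicate v K).criticalIdeal R i = ⊤) :
    minorIdeal ((G.laplacian R).map (evalZeroRename R v K')) i = ⊤ := by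
  rw [← map_minorIdeal, ← criticalIdeal_eq_minorIdeal]
  have := congrArg (Ideal.map (rename Sum.inl :
    MvPolynomial V R →ₐ[R] MvPolynomial (V ⊕ Fin K') R).toRingHom)
    (map_evalZero_criticalIdeal_eq_top R G v h)
  rwa [Ideal.map_map, Ideal.map_top] at this

/-! ### Comparison of the co-ranks. -/

theorem corank_deleteVertex_le [Fintype V] (K : ℕ) :
    (G.deleteVertex v).corank R ≤ (G.duplicate v K).corank R := by
  refine le_corank R _ ?_ ?_
  · refine (corank_le_card R _).trans ((Fintype.card_subtype_le _).trans ?_)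
    simp
  · have h : (((G.duplicate v K).comap
        (fun u : {u : V // u ≠ v} => (Sum.inl u.1 : V ⊕ Fin K))).criticalIdeal R
        ((G.deleteVertex v).corank R)) = ⊤ :=
      criticalIdeal_corank R (G.deleteVertex v)
    have := minorIdeal_laplacian_comap_eq_top R (G.duplicate v K) _
      (Sum.inl_injective.comp Subtype.val_injective) h
    rw [eq_top_iff, ← this]
    exact minorIdeal_submatrix_le _ _ _ _

theorem corank_duplicate_le [Fintype V] :
    (G.duplicate v 1).corank R ≤ (G.deleteVertex v).corank R + 2 := by
  obtain ⟨n, hn⟩ | hlt : (∃ n, (G.duplicate v 1).corank R = n + 2) ∨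
      (G.duplicate v 1).corank R < 2 := by
    rcases lt_or_ge ((G.duplicate v 1).corank R) 2 with h | h
    · exact Or.inr h
    · exact Or.inl ⟨_, (Nat.sub_add_cancel h).symm⟩
  swap
  · omega
  rw [hn]
  refine Nat.add_le_add_right (le_corank R _ ?_ ?_) 2
  · have h1 := corank_le_card R (G.duplicate v 1)
    have h2 : Fintype.card {u : V // u ≠ v} = Fintype.card V - 1 := by simp
    simp only [Fintype.card_sum, Fintype.card_fin] at h1
    omega
  · have htop := criticalIdeal_corank R (G.duplicate v 1)
    rw [hn] at htop
    -- `θ` factors through `x_v = 0` and lands in the ring of `G - v`; removing row and column `v`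
    -- then costs at most two in size.
    let θ : MvPolynomial V R →ₐ[R] MvPolynomial {u : V // u ≠ v} R :=
      aeval fun u => if h : u ≠ v then X ⟨u, h⟩ else 0
    have hθ : θ.comp (evalZero R v) = θ := by
      ext u
      by_cases hu : u = v <;> simp [θ, evalZero, hu]
    have h1 := congrArg (Ideal.map θ.toRingHom) (map_evalZero_criticalIdeal_eq_top R G v htop)
    have h2 : θ.toRingHom.comp (evalZero R v).toRingHom = θ.toRingHom :=
      congrArg AlgHom.toRingHom hθ
    rw [Ideal.map_map, Ideal.map_top, h2, criticalIdeal_eq_minorIdeal, map_minorIdeal] at h1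
    have h3 : ((G.laplacian R).map θ.toRingHom).submatrix (Subtype.val : {u // u ≠ v} → V)
        (Subtype.val : {u // u ≠ v} → V) = (G.deleteVertex v).laplacian R := by
      ext1 p q
      by_cases hpq : p = q
      · subst hpq
        simp [laplacian, θ, p.2]
      · have hpq' : (p : V) ≠ q := fun h => hpq (Subtype.ext h)
        simp [laplacian, θ, hpq, hpq', deleteVertex, comap]
    rw [criticalIdeal_eq_minorIdeal, ← h3, eq_top_iff, ← h1]
    exact minorIdeal_add_two_le _ v n

/-! ### The two inclusions. -/

/-- A product of copy variables times a minor of the Laplacian at `x_v = 0` lies in `J`, provided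
that the minor lifts to `d^K(G, v)` away from these copies. -/
theorem twin_prod_mul_minor_mem [Fintype V] (K : ℕ) (C : Finset (Fin (K + 1))) {a : ℕ}
    (r c : Fin a → V) (s t : Fin (K + 1)) (hs : s ∉ C) (ht : t ∉ C)
    (hst : s ≠ t ∨ ∀ i, r i ≠ v)
    (hlow : ∀ C' : Finset (Fin (K + 1)), C'.card < C.card →
      ∀ g ∈ minorIdeal ((G.laplacian R).map (evalZeroRename R v K)) (C.card + a - C'.card),
        (∏ x ∈ C', X (twin v K x)) * g ∈ (G.duplicate v K).criticalIdeal R (C.card + a)) :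
    (∏ x ∈ C, X (twin v K x)) *
      (((G.laplacian R).map (evalZeroRename R v K)).submatrix r c).det ∈
        (G.duplicate v K).criticalIdeal R (C.card + a) := by
  have hy : ∀ x, twinWeight R v K (twin v K x) = X (twin v K x) := fun x => by
    rw [twinWeight, if_pos (collapse_twin v K x)]
  -- A row `v` lifts to copy `s`, a column `v` to copy `t`. With `s ≠ t` they never share a diagonal
  -- entry; if no row is `v`, the lifted rows have weight zero and `s = t` is allowed.
  have key := leading_term_mem (twinWeight R v K) ((G.laplacian R).map (evalZeroRename R v K))
    (collapse v K) (fun x : C => twin v K x) ((twin_injective v K).comp Subtype.val_injective)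
    (fun i => liftTwin v K s (r i)) (fun i => liftTwin v K t (c i)) ?_ ?_
    ((G.duplicate v K).criticalIdeal R (C.card + a)) ?_ ?_
  · have hr : collapse v K ∘ (fun i => liftTwin v K s (r i)) = r :=
      funext fun i => collapse_liftTwin v K s (r i)
    have hc : collapse v K ∘ (fun i => liftTwin v K t (c i)) = c :=
      funext fun i => collapse_liftTwin v K t (c i)
    rw [hr, hc] at key
    simp only [hy] at key
    rwa [Finset.prod_coe_sort C fun x => (X (twin v K x) : MvPolynomial (V ⊕ Fin K) R)] at key
  · intro x i h
    exact ht (liftTwin_eq_twin v K h.symm ▸ x.2)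
  · intro i
    by_cases hri : r i = v
    · refine Or.inr ⟨fun x h => hs (liftTwin_eq_twin v K h ▸ x.2), fun j h => ?_⟩
      rcases hst with hst | hst
      · rw [liftTwin, if_pos hri] at h
        exact hst (liftTwin_eq_twin v K h.symm).symm
      · exact hst i hri
    · left
      rw [twinWeight, if_neg]
      rwa [collapse_liftTwin]
  · rw [← laplacian_duplicate]
    have := det_submatrix_mem_minorIdeal ((G.duplicate v K).laplacian R)
      (Sum.elim (fun x : C => twin v K x) (fun i => liftTwin v K s (r i)))
      (Sum.elim (fun x : C => twin v K x) (fun i => liftTwin v K t (c i)))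
    simpa [criticalIdeal_eq_minorIdeal] using this
  · intro T hT g hg
    have hcard : T.card < C.card := by
      simpa using Finset.card_lt_univ_of_notMem (Classical.choose_spec
        (not_forall.mp fun h => hT (Finset.eq_univ_iff_forall.mpr h)))
    have := hlow (T.map (Function.Embedding.subtype _)) (by simpa using hcard) g
      (by simpa using hg)
    simpa [hy] using this

/-- The span of the products of at most `k` copy variables with minors of `G` at `x_v = 0`. -/
noncomputable def twinSpan (K j k : ℕ) : Ideal (MvPolynomial (V ⊕ Fin K) R) :=
  Ideal.span {q | ∃ l ≤ k, ∃ p ∈ twinProducts R v K l, ∃ f ∈ G.criticalIdeal R (j - l),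
    q = p * MvPolynomial.rename Sum.inl (evalZero R v f)}

theorem mul_mem_twinSpan {K j k l : ℕ} (hl : l ≤ k) {p g : MvPolynomial (V ⊕ Fin K) R}
    (hp : p ∈ twinProducts R v K l)
    (hg : g ∈ minorIdeal ((G.laplacian R).map (evalZeroRename R v K)) (j - l)) :
    p * g ∈ G.twinSpan R v K j k := by
  refine mul_mem_of_mem_minorIdeal (fun r c => ?_) hg
  refine Ideal.subset_span ⟨l, hl, p, hp, ((G.laplacian R).submatrix r c).det,
    Ideal.subset_span ⟨r, c, rfl⟩, ?_⟩
  congr 1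
  exact (RingHom.map_det (evalZeroRename R v K) _).symm

theorem criticalIdeal_duplicate_le_twinSpan {K d k : ℕ}
    (htop : minorIdeal ((G.laplacian R).map (evalZeroRename R v K)) d = ⊤) :
    (G.duplicate v K).criticalIdeal R (d + k) ≤ G.twinSpan R v K (d + k) k := by
  refine Ideal.span_le.mpr ?_
  rintro _ ⟨r, c, rfl⟩
  rw [laplacian_duplicate, det_submatrix_diagonal_add]
  refine sum_mem fun T _ => ?_
  by_cases hT : ∀ i ∈ T, collapse v K (r i) = v
  · have hprod : ∀ T' ⊆ T, ∏ i ∈ T', twinWeight R v K (r i) ∈ twinProducts R v K T'.card := by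
      intro T' hT'
      have : ∏ i ∈ T', twinWeight R v K (r i) = ∏ i ∈ T', X (r i) :=
        Finset.prod_congr rfl fun i hi => if_pos (hT i (hT' hi))
      rw [this]
      exact prod_mem_twinProducts v K R T' r r.injective.injOn fun i hi => hT i (hT' hi)
    rcases le_or_gt T.card k with hk | hk
    · refine mul_mem_twinSpan R G v hk (hprod T subset_rfl) ?_
      have := det_mem_minorIdeal_of_rows ((G.laplacian R).map (evalZeroRename R v K)) T
        (Matrix.of fun i j => if i ∈ T then (if r i = c j then 1 else 0) else
          ((G.laplacian R).map (evalZeroRename R v K)).submatrix (collapse v K) (collapse v K)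
            (r i) (c j)) (collapse v K ∘ r) (collapse v K ∘ c)
        (fun i hi j => by simp [hi])
      rwa [Fintype.card_fin] at this
    -- Any `k` of the variables suffice: the cofactor has size `d`, where the minor ideal is
    -- everything.
    · obtain ⟨T', hT', hcard⟩ := Finset.exists_subset_card_eq hk.le
      rw [← Finset.prod_sdiff hT', mul_comm (∏ i ∈ T \ T', _), mul_assoc]
      have h := hprod T' hT'
      rw [hcard] at h
      refine mul_mem_twinSpan R G v le_rfl h ?_
      rw [Nat.add_sub_cancel, htop]
      trivial
  · push Not at hT
    obtain ⟨i, hi, hv⟩ := hT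
    rw [Finset.prod_eq_zero hi (if_neg hv), zero_mul]
    exact zero_mem _

theorem twin_prod_mul_mem_criticalIdeal [Fintype V] {K d k : ℕ}
    (hK : k + 1 ≤ K ∨ k = K ∧
      minorIdeal (((G.laplacian R).map (evalZeroRename R v K)).submatrix
        (Subtype.val : {u // u ≠ v} → V) (Subtype.val : {u // u ≠ v} → V)) d = ⊤)
    (l : ℕ) (hl : l ≤ k) (C : Finset (Fin (K + 1))) (hC : C.card = l)
    (g : MvPolynomial (V ⊕ Fin K) R)
    (hg : g ∈ minorIdeal ((G.laplacian R).map (evalZeroRename R v K)) (d + k - l)) :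
    (∏ x ∈ C, X (twin v K x)) * g ∈ (G.duplicate v K).criticalIdeal R (d + k) := by
  induction l using Nat.strong_induction_on generalizing C g with
  | _ l ih =>
  subst hC
  have hsize : C.card + (d + k - C.card) = d + k := by omega
  have hlow : ∀ C' : Finset (Fin (K + 1)), C'.card < C.card →
      ∀ g ∈ minorIdeal ((G.laplacian R).map (evalZeroRename R v K))
        (C.card + (d + k - C.card) - C'.card),
        (∏ x ∈ C', X (twin v K x)) * g ∈
          (G.duplicate v K).criticalIdeal R (C.card + (d + k - C.card)) := by
    rw [hsize]
    exact fun C' hC' g hg => ih _ hC' (by omega) C' rfl g hg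
  have hcompl : Cᶜ.card = K + 1 - C.card := by simp [Finset.card_compl]
  -- There are `K + 1` copies, so this says that two of them lie outside `C`.
  by_cases hlt : C.card + 1 ≤ K
  · obtain ⟨s, hs, t, ht, hst⟩ := Finset.one_lt_card.mp (by omega : 1 < Cᶜ.card)
    refine mul_mem_of_mem_minorIdeal (fun r c => ?_) hg
    have := twin_prod_mul_minor_mem R G v K C r c s t (Finset.mem_compl.mp hs)
      (Finset.mem_compl.mp ht) (Or.inl hst) hlow
    rwa [hsize] at this
  · obtain ⟨rfl, htop⟩ : k = K ∧ _ := hK.resolve_left (by omega)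
    have hCk : C.card = k := by omega
    obtain ⟨s, hs⟩ := Finset.card_pos.mp (by omega : 0 < Cᶜ.card)
    have hd : d + k - C.card = d := by omega
    rw [hd] at hlow hsize
    -- Only one copy is free, but `g` can be rewritten through minors that avoid row and column `v`.
    have hg' : g ∈ minorIdeal (((G.laplacian R).map (evalZeroRename R v k)).submatrix
        (Subtype.val : {u // u ≠ v} → V) (Subtype.val : {u // u ≠ v} → V)) d := by
      rw [htop]; trivial
    refine mul_mem_of_mem_minorIdeal (fun r c => ?_) hg'
    have := twin_prod_mul_minor_mem R G v k C (fun i => (r i : V)) (fun i => (c i : V)) s s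
      (Finset.mem_compl.mp hs) (Finset.mem_compl.mp hs) (Or.inr fun i => (r i).2) hlow
    rw [hsize] at this
    simpa [Function.comp_def] using this

theorem twinSpan_le_criticalIdeal_duplicate [Fintype V] {K d k : ℕ}
    (hK : k + 1 ≤ K ∨ k = K ∧
      minorIdeal (((G.laplacian R).map (evalZeroRename R v K)).submatrix
        (Subtype.val : {u // u ≠ v} → V) (Subtype.val : {u // u ≠ v} → V)) d = ⊤) :
    G.twinSpan R v K (d + k) k ≤ (G.duplicate v K).criticalIdeal R (d + k) := by
  refine Ideal.span_le.mpr ?_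
  rintro _ ⟨l, hl, _, ⟨C, hC, rfl⟩, f, hf, rfl⟩
  refine twin_prod_mul_mem_criticalIdeal R G v hK l hl C hC _ ?_
  rw [← map_minorIdeal]
  exact Ideal.mem_map_of_mem (evalZeroRename R v K) hf

end SignedMultidigraph

open SignedMultidigraph in
theorem mainTheorem3 {V : Type*} [Fintype V] [DecidableEq V] (R : Type*) [CommRing R]
    [Nontrivial R] (G : SignedMultidigraph V) (v : V) (γd γv lam : ℕ)
    (hγd : γd = (G.duplicate v 1).corank R) (hγv : γv = (G.deleteVertex v).corank R)
    (hlam : lam = regularityConst γv γd) (hG : 2 ≤ G.corank R) :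
    (0 ≤ (γd : ℤ) - (γv : ℤ) ∧ (γd : ℤ) - (γv : ℤ) ≤ 2) ∧
    ∀ k i : ℕ, 1 ≤ k →
      (G.duplicate v (k + lam + i)).criticalIdeal R (γd + k) =
        Ideal.span {q | ∃ l ≤ k, ∃ p ∈ twinProducts R v (k + lam + i) l,
          ∃ f ∈ G.criticalIdeal R (γd + k - l),
            q = p * MvPolynomial.rename Sum.inl (evalZero R v f)} := by
  refine ⟨?_, fun k i _ => ?_⟩
  · have h1 := corank_deleteVertex_le R G v 1
    have h2 := corank_duplicate_le R G v
    omega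
  · have htop : (G.duplicate v 1).criticalIdeal R γd = ⊤ := hγd ▸ criticalIdeal_corank R _
    refine le_antisymm (criticalIdeal_duplicate_le_twinSpan R G v
      (map_evalZeroRename_eq_top R G v _ htop)) ?_
    refine twinSpan_le_criticalIdeal_duplicate R G v ?_
    -- This fails only for `lam = i = 0`, which forces `γv = γd`.
    by_cases h : k + 1 ≤ k + lam + i
    · exact Or.inl h
    · have hlam0 : lam = 0 := by omega
      have heq : γv = γd := by
        by_contra hne
        rw [regularityConst, if_neg hne] at hlam
        omega
      refine Or.inr ⟨by omega, ?_⟩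
      have hv : (G.comap (Subtype.val : {u // u ≠ v} → V)).criticalIdeal R γd = ⊤ := by
        rw [← heq, hγv]
        exact criticalIdeal_corank R (G.deleteVertex v)
      have := minorIdeal_laplacian_comap_eq_top R G _ Subtype.val_injective hv
      rw [Matrix.submatrix_map, ← map_minorIdeal, this, Ideal.map_top]
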